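/- Let $d, D \ge 0$ and $M \ge 1$ be integers. Consider the linear latent dynamical system $$x_{t+1} = f(x_t) + \varepsilon_t,\qquad y_t = g(x_t),\qquad f(x) = Ax,$$ where $A \in \mathbb{R}^{d\times d}$ is invertible (that is, $f$ is bijective), the noise $\varepsilon_t \sim \mathcal{N}(0,\Sigma)$ is i.i.d. with positive definite $\Sigma$, and $g : \mathbb{R}^d \to \mathbb{R}^D$ is injective and measurable. Let $q$ be the marginal distribution of the latent data (the law of $x_t$ for a uniformly drawn time index, in the limit of infinitely many time steps), a probability distribution on $\mathbb{R}^d$ with everywhere positive density, also written $q$. A dynamics contrastive learning (DCL) model with linear dynamics consists of a measurable encoder $h : \mathbb{R}^D \to \mathbb{R}^d$, a dynamics model $\hat f(x) = \hat A x$ with $\hat A \in \mathbb{R}^{d\times d}$, and a correction term $\alpha : \mathbb{R}^D \to \mathbb{R}$ with $\alpha(g(x)) = \log q(x)$ for all $x$; its score is $$\psi(y,y') = -\|\hat f(h(y)) - h(y')\|^2 - \alpha(y').$$ Its contrastive loss with $M$ negative samples, in the limit of infinitely many time steps, is $$\mathcal{L}[\psi] = \mathbb{E}\Big[-\psi(y,y^+)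 + \log\Big(e^{\psi(y,y^+)} + \sum_{m=1}^{M} e^{\psi(y,y^-_m)}\Big)\Big] \in [0,\infty],$$ where $y = g(x)$ with $x \sim q$, $y^+ = g(Ax + \varepsilon)$ with $\varepsilon \sim \mathcal{N}(0,\Sigma)$ independent of $x$, and $y^-_m = g(x_m)$ with $x_1,\dots,x_M \sim q$ i.i.d. and independent of $(x,\varepsilon)$. Suppose that $(h, \hat A)$ attains the global minimum of $\mathcal{L}$ among all measurable encoders and all matrices in $\mathbb{R}^{d\times d}$ (with this $\alpha$). Then there are an invertible matrix $L \in \mathbb{R}^{d\times d}$ and a vector $b \in \mathbb{R}^d$ such that $$h(g(x)) = Lx + b \quad\text{for } q\text{-almost every } x,\qquad\text{and}\qquad \hat A = L A L^{-1}.$$ If moreover $h\circ g$ is continuous, then $h(g(x)) = Lx+b$ for every $x \in \mathbb{R}^d$. -/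

import Mathlib

open MeasureTheory ProbabilityTheory Matrix
open scoped ENNReal

noncomputable section

/-- The linear dynamics `x ↦ A x` on Euclidean space `ℝᵈ`. -/
def linearDynamics {d : ℕ} (A : Matrix (Fin d) (Fin d) ℝ) :
    EuclideanSpace ℝ (Fin d) → EuclideanSpace ℝ (Fin d) :=
  fun x => Matrix.toEuclideanCLM (𝕜 := ℝ) A x

/-- The score `ψ(y, y') = φ(f̂(h(y)), h(y')) - α(y')` of a dynamics contrastive learning model with
encoder `h`, dynamics model `f̂`, correction term `α` and similarity `φ(u, v) = -‖u - v‖²`. -/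
def dclScore {d D : ℕ}
    (h : EuclideanSpace ℝ (Fin D) → EuclideanSpace ℝ (Fin d))
    (fhat : EuclideanSpace ℝ (Fin d) → EuclideanSpace ℝ (Fin d))
    (α : EuclideanSpace ℝ (Fin D) → ℝ)
    (y y' : EuclideanSpace ℝ (Fin D)) : ℝ :=
  -‖fhat (h y) - h y'‖ ^ 2 - α y'

/-- The log-likelihood of a score `ψ` for the reference sample `y`, the positive sample `ypos`
and `M` negative samples `yneg`:
`ψ(y, y⁺) - log ∑_{y⁻ ∈ N ∪ {y⁺}} exp ψ(y, y⁻)`. It is never positive. -/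
def contrastiveLogLik {Y : Type*} {M : ℕ} (ψ : Y → Y → ℝ) (y ypos : Y) (yneg : Fin M → Y) : ℝ :=
  ψ y ypos - Real.log (Real.exp (ψ y ypos) + ∑ m, Real.exp (ψ y (yneg m)))

/-- The joint law of two consecutive latents `(x, x')`, where `x` follows the data marginal `q`
and `x' = f(x) + ε` with noise `ε ∼ 𝒩(0, S)` independent of `x`. -/
def consecutiveLatentLaw {d : ℕ} (f : EuclideanSpace ℝ (Fin d) → EuclideanSpace ℝ (Fin d))
    (S : Matrix (Fin d) (Fin d) ℝ) (q : Measure (EuclideanSpace ℝ (Fin d))) :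
    Measure (EuclideanSpace ℝ (Fin d) × EuclideanSpace ℝ (Fin d)) :=
  (q.prod (multivariateGaussian 0 S)).map (fun p => (p.1, f p.1 + p.2))

/-- The contrastive loss with `M` negative samples, in the limit of infinitely many time steps:
the expected negative log-likelihood of the score `ψ`, where reference and positive sample are the
observations `g(x)`, `g(x')` of consecutive latents, and the negative samples are observations of
`M` independent latents drawn from the data marginal `q`. The integrand is the nonnegative number
`-contrastiveLogLik`, so the loss is a well-defined element of `[0, ∞]` for every model. -/
def dclLoss {d D : ℕ} (M : ℕ) (f : EuclideanSpace ℝ (Fin d) → EuclideanSpace ℝ (Fin d))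
    (S : Matrix (Fin d) (Fin d) ℝ) (q : Measure (EuclideanSpace ℝ (Fin d)))
    (g : EuclideanSpace ℝ (Fin d) → EuclideanSpace ℝ (Fin D))
    (ψ : EuclideanSpace ℝ (Fin D) → EuclideanSpace ℝ (Fin D) → ℝ) : ℝ≥0∞ :=
  ∫⁻ p, ∫⁻ n : Fin M → EuclideanSpace ℝ (Fin d),
      ENNReal.ofReal (-contrastiveLogLik ψ (g p.1) (g p.2) (fun m => g (n m)))
    ∂(Measure.pi fun _ => q) ∂(consecutiveLatentLaw f S q)

end

/-! The loss is the cross-entropy of guessing which of `M + 1` latents is the true successor of `x`.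
Positive pairs have density `r x x' = k * exp (-‖T (x' - A x)‖ ^ 2) / ρ x'` with respect to
independent pairs, where `T` is the rescaled whitening of the noise, so the Bayes posterior is the
softmax of `r`. The class of models contains this optimum: `h ∘ g = T` with dynamics `T A T⁻¹` has
exponentiated score `k⁻¹ * r`, because `α` supplies the division by `ρ`. By the equality case of
Gibbs' inequality every minimiser has the same softmax almost everywhere, hence a score proportional
to `r` in `x'` (`ae_exists_eq_mul_of_contrastive_loss_le`).

With `v = h ∘ g`, logarithms give `‖Â v(x) - v(x')‖² = ‖T A x - T x'‖² + c(x)`. Subtracting this at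
two values of `x` removes the terms quadratic in `x'` and shows that some inner products with
`v(x')` are affine in `x'`. As `A` is surjective and `q` has full support, there are enough of them
to force `v` to be affine and invertible (`affinelyReadable_eq_top`,
`ae_eq_affine_of_affinelyReadable`). Substituting `v(x) = L x + b` and comparing coefficients in
`x'` yields `Â L = L A` (`intertwines_of_norm_sub_sq_eq`). -/

open scoped RealInnerProductSpace

/-! ### Gibbs' inequality -/

/-- Equality case of Gibbs' inequality for the conditional probabilities `P`, `Q`. -/
theorem ae_eq_of_lintegral_neg_log_le {Z : Type*} [MeasurableSpace Z] {μ : Measure Z}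
    [IsProbabilityMeasure μ] {P Q : Z → ℝ} (hP : Measurable P) (hQ : Measurable Q)
    (hP0 : ∀ z, 0 < P z) (hQ0 : ∀ z, 0 < Q z) (hP1 : ∀ z, P z ≤ 1) (hQ1 : ∀ z, Q z ≤ 1)
    (hfin : ∫⁻ z, ENNReal.ofReal (1 / P z) ∂μ ≠ ∞)
    (hratio : ∫⁻ z, ENNReal.ofReal (Q z / P z) ∂μ ≤ 1)
    (hle : ∫⁻ z, ENNReal.ofReal (-Real.log (Q z)) ∂μ ≤
      ∫⁻ z, ENNReal.ofReal (-Real.log (P z)) ∂μ) :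
    P =ᵐ[μ] Q := by
  have hPl : ∀ z, 0 ≤ -Real.log (P z) := fun z =>
    neg_nonneg.2 (Real.log_nonpos (hP0 z).le (hP1 z))
  have hQl : ∀ z, 0 ≤ -Real.log (Q z) := fun z =>
    neg_nonneg.2 (Real.log_nonpos (hQ0 z).le (hQ1 z))
  -- The reference loss must be finite for the two losses to be subtracted; `-log P ≤ 1 / P`
  -- supplies this.
  have hPfin : ∫⁻ z, ENNReal.ofReal (-Real.log (P z)) ∂μ ≠ ∞ := by
    refine ne_top_of_le_ne_top hfin (lintegral_mono fun z => ENNReal.ofReal_le_ofReal ?_)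
    have := Real.log_le_sub_one_of_pos (one_div_pos.2 (hP0 z))
    rw [one_div, Real.log_inv] at this
    rw [one_div]
    linarith
  have hPi : Integrable (fun z => -Real.log (P z)) μ :=
    (lintegral_ofReal_ne_top_iff_integrable hP.log.neg.aestronglyMeasurable (.of_forall hPl)).1 hPfin
  have hQi : Integrable (fun z => -Real.log (Q z)) μ :=
    (lintegral_ofReal_ne_top_iff_integrable hQ.log.neg.aestronglyMeasurable (.of_forall hQl)).1
      (ne_top_of_le_ne_top hPfin hle)
  have hR0 : ∀ z, 0 < Q z / P z := fun z => div_pos (hQ0 z) (hP0 z)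
  have hRi : Integrable (fun z => Q z / P z) μ :=
    (lintegral_ofReal_ne_top_iff_integrable (hQ.div hP).aestronglyMeasurable
      (.of_forall fun z => (hR0 z).le)).1
      (ne_top_of_le_ne_top ENNReal.one_ne_top hratio)
  have hRint : ∫ z, Q z / P z ∂μ ≤ 1 := by
    rw [integral_eq_lintegral_of_nonneg_ae (.of_forall fun z => (hR0 z).le)
      (hQ.div hP).aestronglyMeasurable]
    exact ENNReal.toReal_mono ENNReal.one_ne_top hratio
  have hlint : ∫ z, -Real.log (Q z) ∂μ ≤ ∫ z, -Real.log (P z) ∂μ := by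
    rw [integral_eq_lintegral_of_nonneg_ae (.of_forall hQl) hQ.log.neg.aestronglyMeasurable,
      integral_eq_lintegral_of_nonneg_ae (.of_forall hPl) hP.log.neg.aestronglyMeasurable]
    exact ENNReal.toReal_mono hPfin hle
  have hlog : ∀ z, Real.log (Q z / P z) = Real.log (Q z) - Real.log (P z) := fun z =>
    Real.log_div (hQ0 z).ne' (hP0 z).ne'
  -- This is `log t ≤ t - 1` at `t = Q / P`. Its integral is at most zero, so equality, that is `t =
  -- 1`, holds almost everywhere.
  have hgap : ∀ z, 0 ≤ (Q z / P z - 1) + (-Real.log (Q z) - -Real.log (P z)) := fun z => by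
    have := Real.log_le_sub_one_of_pos (hR0 z)
    rw [hlog] at this
    linarith
  have hsum : Integrable (fun z => (Q z / P z - 1) + (-Real.log (Q z) - -Real.log (P z))) μ :=
    (hRi.sub (integrable_const 1)).add (hQi.sub hPi)
  have hzero : ∫ z, (Q z / P z - 1) + (-Real.log (Q z) - -Real.log (P z)) ∂μ = 0 := by
    refine le_antisymm ?_ (integral_nonneg hgap)
    have h1 := integral_add (hRi.sub (integrable_const 1)) (hQi.sub hPi)
    simp only [Pi.sub_apply] at h1
    rw [h1, integral_sub hRi (integrable_const 1), integral_sub hQi hPi]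
    simp only [integral_const, probReal_univ, smul_eq_mul, mul_one]
    linarith
  have hae := (integral_eq_zero_iff_of_nonneg hgap hsum).1 hzero
  filter_upwards [hae] with z hz
  by_contra hne
  have hne' : Q z / P z ≠ 1 := fun h1 => hne ((div_eq_one_iff_eq (hP0 z).ne').1 h1).symm
  have := Real.log_lt_sub_one_of_pos (hR0 z) hne'
  rw [hlog] at this
  simp only [Pi.zero_apply] at hz
  linarith

/-! ### Minimisers of the contrastive loss -/

/-- Exchanging two coordinates of an i.i.d. sample does not change its law. -/
theorem lintegral_pi_swap {X ι : Type*} [MeasurableSpace X] [Fintype ι] [DecidableEq ι]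
    (q : Measure X) [SigmaFinite q] (i j : ι) (F : (ι → X) → ℝ≥0∞) :
    ∫⁻ z, F (fun k => z (Equiv.swap i j k)) ∂(Measure.pi fun _ => q) =
      ∫⁻ z, F z ∂(Measure.pi fun _ => q) := by
  have h := measurePreserving_piCongrLeft (fun _ : ι => q) (Equiv.swap i j)
  refine Eq.trans ?_ (MeasurePreserving.lintegral_map_equiv F _ h).symm
  refine lintegral_congr fun z => congrArg F (funext fun k => ?_)
  obtain ⟨l, rfl⟩ := (Equiv.swap i j).surjective k
  rw [Equiv.swap_apply_self]
  exact (Equiv.piCongrLeft_apply_apply (fun _ : ι => X) (Equiv.swap i j) z l).symm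

/-- Splitting off the first coordinate of an i.i.d. sample. -/
theorem lintegral_pi_fin_succ {X : Type*} [MeasurableSpace X] {M : ℕ}
    (q : Measure X) [SigmaFinite q] {F : (Fin (M + 1) → X) → ℝ≥0∞} (hF : Measurable F) :
    ∫⁻ z, F z ∂(Measure.pi fun _ => q) =
      ∫⁻ x, ∫⁻ n : Fin M → X, F (Fin.cons x n) ∂(Measure.pi fun _ => q) ∂q := by
  have h := (measurePreserving_piFinSuccAbove (fun _ : Fin (M + 1) => q) 0).symm
  refine (MeasurePreserving.lintegral_map_equiv F _ h).trans ?_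
  rw [lintegral_prod]
  · simp [MeasurableEquiv.piFinSuccAbove, Fin.insertNthEquiv]
  · fun_prop

/-- A score whose contrastive loss is at most that of the density `r` of positive pairs with respect
to independent pairs is proportional to `r` in its second argument. -/
theorem ae_exists_eq_mul_of_contrastive_loss_le {X : Type*} [MeasurableSpace X]
    (q : Measure X) [IsProbabilityMeasure q] {M : ℕ} (hM : 1 ≤ M) {r s : X → X → ℝ}
    (hr : Measurable (Function.uncurry r)) (hs : Measurable (Function.uncurry s))
    (hr0 : ∀ x x', 0 < r x x') (hs0 : ∀ x x', 0 < s x x')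
    (hr1 : ∫⁻ x, ∫⁻ x', ENNReal.ofReal (r x x') ∂q ∂q = 1)
    (hle : ∫⁻ x, ∫⁻ z : Fin (M + 1) → X, ENNReal.ofReal (r x (z 0)) *
          ENNReal.ofReal (-Real.log (s x (z 0) / ∑ i, s x (z i))) ∂(Measure.pi fun _ => q) ∂q ≤
        ∫⁻ x, ∫⁻ z : Fin (M + 1) → X, ENNReal.ofReal (r x (z 0)) *
          ENNReal.ofReal (-Real.log (r x (z 0) / ∑ i, r x (z i))) ∂(Measure.pi fun _ => q) ∂q) :
    ∀ᵐ x ∂q, ∃ c > 0, ∀ᵐ x' ∂q, s x x' = c * r x x' := by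
  set π : Measure (Fin (M + 1) → X) := Measure.pi fun _ => q with hπ
  have mr : ∀ i, Measurable fun p : X × (Fin (M + 1) → X) => r p.1 (p.2 i) := fun i =>
    hr.comp (measurable_fst.prodMk ((measurable_pi_apply i).comp measurable_snd))
  have ms : ∀ i, Measurable fun p : X × (Fin (M + 1) → X) => s p.1 (p.2 i) := fun i =>
    hs.comp (measurable_fst.prodMk ((measurable_pi_apply i).comp measurable_snd))
  have mR : Measurable fun p : X × (Fin (M + 1) → X) => ∑ i, r p.1 (p.2 i) :=
    Finset.measurable_sum _ fun i _ => mr i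
  have mS : Measurable fun p : X × (Fin (M + 1) → X) => ∑ i, s p.1 (p.2 i) :=
    Finset.measurable_sum _ fun i _ => ms i
  have hR0 : ∀ p : X × (Fin (M + 1) → X), 0 < ∑ i, r p.1 (p.2 i) := fun p =>
    Finset.sum_pos (fun i _ => hr0 _ _) Finset.univ_nonempty
  have hS0 : ∀ p : X × (Fin (M + 1) → X), 0 < ∑ i, s p.1 (p.2 i) := fun p =>
    Finset.sum_pos (fun i _ => hs0 _ _) Finset.univ_nonempty
  -- The law of a reference with its candidates: coordinate 0 is the positive sample, the others are
  -- negatives.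
  set μ : Measure (X × (Fin (M + 1) → X)) :=
    (q.prod π).withDensity fun p => ENNReal.ofReal (r p.1 (p.2 0)) with hμ
  have hint : ∀ F : X × (Fin (M + 1) → X) → ℝ≥0∞, Measurable F →
      ∫⁻ p, F p ∂μ = ∫⁻ x, ∫⁻ z, ENNReal.ofReal (r x (z 0)) * F (x, z) ∂π ∂q := fun F hF => by
    rw [hμ, lintegral_withDensity_eq_lintegral_mul _ (mr 0).ennreal_ofReal hF,
      lintegral_prod _ (((mr 0).ennreal_ofReal.mul hF).aemeasurable)]
    rfl
  have hmarg : ∀ i, ∫⁻ x, ∫⁻ z, ENNReal.ofReal (r x (z i)) ∂π ∂q = 1 := fun i => by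
    rw [← hr1]
    refine lintegral_congr fun x => ?_
    have hm : Measurable fun x' => ENNReal.ofReal (r x x') :=
      (hr.comp measurable_prodMk_left).ennreal_ofReal
    exact (measurePreserving_eval (fun _ : Fin (M + 1) => q) i).lintegral_comp hm
  have hprob : IsProbabilityMeasure μ := ⟨by
    have := hint (fun _ => 1) measurable_const
    simpa [hmarg 0] using this⟩
  have hPQ := ae_eq_of_lintegral_neg_log_le (μ := μ)
    (P := fun p => r p.1 (p.2 0) / ∑ i, r p.1 (p.2 i))
    (Q := fun p => s p.1 (p.2 0) / ∑ i, s p.1 (p.2 i))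
    ((mr 0).div mR) ((ms 0).div mS) (fun p => div_pos (hr0 _ _) (hR0 p))
    (fun p => div_pos (hs0 _ _) (hS0 p))
    (fun p => (div_le_one (hR0 p)).2 (Finset.single_le_sum
      (f := fun i => r p.1 (p.2 i)) (fun i _ => (hr0 _ _).le) (Finset.mem_univ 0)))
    (fun p => (div_le_one (hS0 p)).2 (Finset.single_le_sum
      (f := fun i => s p.1 (p.2 i)) (fun i _ => (hs0 _ _).le) (Finset.mem_univ 0)))
    (by
      have m : Measurable fun p : X × (Fin (M + 1) → X) =>
          ENNReal.ofReal (1 / (r p.1 (p.2 0) / ∑ i, r p.1 (p.2 i))) :=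
        (measurable_const.div ((mr 0).div mR)).ennreal_ofReal
      rw [hint _ m]
      -- The weight `r` cancels the numerator of `P`, leaving `M + 1` terms of integral one.
      have : ∀ x (z : Fin (M + 1) → X), ENNReal.ofReal (r x (z 0)) *
          ENNReal.ofReal (1 / (r x (z 0) / ∑ i, r x (z i))) =
          ∑ i, ENNReal.ofReal (r x (z i)) := fun x z => by
        rw [← ENNReal.ofReal_mul (hr0 _ _).le,
          ← ENNReal.ofReal_sum_of_nonneg fun i _ => (hr0 _ _).le]
        congr 1
        have := (hr0 x (z 0)).ne'
        field_simp
      simp_rw [this]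
      have h2 : ∫⁻ x, ∫⁻ z : Fin (M + 1) → X, ∑ i, ENNReal.ofReal (r x (z i)) ∂π ∂q =
          ∑ i, ∫⁻ x, ∫⁻ z : Fin (M + 1) → X, ENNReal.ofReal (r x (z i)) ∂π ∂q := by
        rw [← lintegral_finsetSum]
        · refine lintegral_congr fun x => lintegral_finsetSum _ fun i _ => ?_
          exact (mr i).ennreal_ofReal.comp measurable_prodMk_left
        · exact fun i _ => (mr i).ennreal_ofReal.lintegral_prod_right'
      rw [h2]
      simp [hmarg])
    (by
      have m : Measurable fun p : X × (Fin (M + 1) → X) => ENNReal.ofReal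
          (s p.1 (p.2 0) / (∑ i, s p.1 (p.2 i)) / (r p.1 (p.2 0) / ∑ i, r p.1 (p.2 i))) :=
        (((ms 0).div mS).div ((mr 0).div mR)).ennreal_ofReal
      rw [hint _ m]
      have mj : ∀ i j, Measurable fun p : X × (Fin (M + 1) → X) =>
          ENNReal.ofReal (r p.1 (p.2 i) * (s p.1 (p.2 j) / ∑ k, s p.1 (p.2 k))) := fun i j =>
        ((mr i).mul ((ms j).div mS)).ennreal_ofReal
      have h1 : ∀ x (z : Fin (M + 1) → X), ENNReal.ofReal (r x (z 0)) *
          ENNReal.ofReal (s x (z 0) / (∑ i, s x (z i)) / (r x (z 0) / ∑ i, r x (z i))) =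
          ∑ i, ENNReal.ofReal (r x (z i) * (s x (z 0) / ∑ k, s x (z k))) := fun x z => by
        rw [← ENNReal.ofReal_mul (hr0 _ _).le,
          ← ENNReal.ofReal_sum_of_nonneg fun i _ =>
            (mul_pos (hr0 _ _) (div_pos (hs0 _ _) (hS0 (x, z)))).le, ← Finset.sum_mul]
        congr 1
        have := (hr0 x (z 0)).ne'
        field_simp
      have h2 : ∀ x (z : Fin (M + 1) → X),
          ∑ i, ENNReal.ofReal (r x (z 0) * (s x (z i) / ∑ k, s x (z k))) =
          ENNReal.ofReal (r x (z 0)) := fun x z => by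
        rw [← ENNReal.ofReal_sum_of_nonneg fun i _ =>
            (mul_pos (hr0 _ _) (div_pos (hs0 _ _) (hS0 (x, z)))).le, ← Finset.mul_sum,
            ← Finset.sum_div, div_self (hS0 (x, z)).ne', mul_one]
      -- Exchangeability moves the index from `r` to `s`; the softmax weights of `s` then sum to
      -- one, so `Q / P` has mean one.
      have h3 : ∀ x i, ∫⁻ z, ENNReal.ofReal (r x (z i) * (s x (z 0) / ∑ k, s x (z k))) ∂π =
          ∫⁻ z, ENNReal.ofReal (r x (z 0) * (s x (z i) / ∑ k, s x (z k))) ∂π := fun x i => by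
        rw [← lintegral_pi_swap q 0 i]
        refine lintegral_congr fun z => ?_
        beta_reduce
        rw [Equiv.swap_apply_left, Equiv.swap_apply_right,
          Equiv.sum_comp (Equiv.swap 0 i) fun k => s x (z k)]
      simp_rw [h1]
      refine le_of_eq ?_
      rw [← hmarg 0]
      refine lintegral_congr fun x => ?_
      simp_rw [← h2 x]
      exact (lintegral_finsetSum _ fun i _ => (mj i 0).comp measurable_prodMk_left).trans
        ((Finset.sum_congr rfl fun i _ => h3 x i).trans
          (lintegral_finsetSum _ fun i _ => (mj 0 i).comp measurable_prodMk_left).symm))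
    (by
      have ms' : Measurable fun p : X × (Fin (M + 1) → X) =>
          ENNReal.ofReal (-Real.log (s p.1 (p.2 0) / ∑ i, s p.1 (p.2 i))) :=
        ((ms 0).div mS).log.neg.ennreal_ofReal
      have mr' : Measurable fun p : X × (Fin (M + 1) → X) =>
          ENNReal.ofReal (-Real.log (r p.1 (p.2 0) / ∑ i, r p.1 (p.2 i))) :=
        ((mr 0).div mR).log.neg.ennreal_ofReal
      rw [hint _ ms', hint _ mr']
      exact hle)
  have hPQ' : ∀ᵐ p ∂(q.prod π), r p.1 (p.2 0) / ∑ i, r p.1 (p.2 i) =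
      s p.1 (p.2 0) / ∑ i, s p.1 (p.2 i) := by
    have := (ae_withDensity_iff (mr 0).ennreal_ofReal).1 hPQ
    filter_upwards [this] with p hp
    exact hp (ENNReal.ofReal_pos.2 (hr0 _ _)).ne'
  have hae := Measure.ae_ae_of_ae_prod hPQ'
  filter_upwards [hae] with x hx
  -- The negatives are frozen at one generic value `n` while the positive varies. This needs `M ≥
  -- 1`: without negatives both softmaxes are constantly one.
  have hsplit :=
    (measurePreserving_piFinSuccAbove (fun _ : Fin (M + 1) => q) 0).symm.quasiMeasurePreserving.ae hx
  have hswap := Measure.ae_ae_of_ae_prod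
    (Measure.measurePreserving_swap.quasiMeasurePreserving.ae hsplit)
  obtain ⟨n, hn⟩ := hswap.exists
  have : Nonempty (Fin M) := ⟨⟨0, hM⟩⟩
  have hrn : 0 < ∑ i, r x (n i) := Finset.sum_pos (fun i _ => hr0 _ _) Finset.univ_nonempty
  have hsn : 0 < ∑ i, s x (n i) := Finset.sum_pos (fun i _ => hs0 _ _) Finset.univ_nonempty
  refine ⟨(∑ i, s x (n i)) / ∑ i, r x (n i), div_pos hsn hrn, ?_⟩
  filter_upwards [hn] with x' hx'
  simp only [MeasurableEquiv.piFinSuccAbove, Fin.insertNthEquiv, Prod.swap, Fin.sum_univ_succ,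
    MeasurableEquiv.symm_mk, MeasurableEquiv.coe_mk, Equiv.symm_symm, Equiv.coe_fn_mk,
    Fin.insertNth_zero', Fin.cons_zero, Fin.cons_succ] at hx'
  rw [div_eq_div_iff (add_pos (hr0 _ _) hrn).ne' (add_pos (hs0 _ _) hsn).ne'] at hx'
  field_simp
  linarith

/-! ### Gaussian densities and the law of consecutive latents -/

/-- The standard Gaussian measure has density proportional to `exp (-‖x‖² / 2)`. -/
theorem stdGaussian_eq_withDensity {E : Type*} [NormedAddCommGroup E] [InnerProductSpace ℝ E]
    [FiniteDimensional ℝ E] [MeasurableSpace E] [BorelSpace E] :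
    ∃ k : ℝ, 0 < k ∧ stdGaussian E =
      (volume : Measure E).withDensity fun x => ENNReal.ofReal (k * Real.exp (-(1 / 2) * ‖x‖ ^ 2)) := by
  set d := Module.finrank ℝ E
  have hC : (0 : ℝ) < (Real.pi / (1 / 2)) ^ (d / 2 : ℝ) := by positivity
  set C : ℝ := (Real.pi / (1 / 2)) ^ (d / 2 : ℝ) with hCdef
  have hCI : ∫ x : E, Real.exp (-(1 / 2) * ‖x‖ ^ 2) = C :=
    GaussianFourier.integral_rexp_neg_mul_sq_norm (by norm_num)
  -- A non-integrable function would have integral zero by convention, but this one has integral `C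
  -- > 0`.
  have hint : Integrable fun x : E => Real.exp (-(1 / 2) * ‖x‖ ^ 2) :=
    by_contra fun hn => hC.ne' (by rw [← hCI, integral_undef hn])
  have hm : Measurable fun x : E => C⁻¹ * Real.exp (-(1 / 2) * ‖x‖ ^ 2) := by fun_prop
  have h0 : ∀ x : E, 0 ≤ C⁻¹ * Real.exp (-(1 / 2) * ‖x‖ ^ 2) := fun x => by positivity
  refine ⟨C⁻¹, inv_pos.2 hC, ?_⟩
  have hfin : IsFiniteMeasure ((volume : Measure E).withDensity
      fun x => ENNReal.ofReal (C⁻¹ * Real.exp (-(1 / 2) * ‖x‖ ^ 2))) :=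
    isFiniteMeasure_withDensity_ofReal (hint.const_mul _).2
  refine Measure.ext_of_charFun (funext fun t => ?_)
  rw [charFun_stdGaussian, charFun_apply,
    integral_withDensity_eq_integral_toReal_smul hm.ennreal_ofReal
      (.of_forall fun _ => ENNReal.ofReal_lt_top)]
  -- The characteristic function is the Gaussian integral with linear term `I * ⟪t, x⟫`.
  have key := GaussianFourier.integral_cexp_neg_mul_sq_norm_add (V := E) (b := (1 / 2 : ℂ))
    (by norm_num) Complex.I t
  have hcongr : ∀ x : E, (ENNReal.ofReal (C⁻¹ * Real.exp (-(1 / 2) * ‖x‖ ^ 2))).toReal •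
      Complex.exp (⟪x, t⟫ * Complex.I) =
      ((C⁻¹ : ℝ) : ℂ) * Complex.exp (-(1 / 2 : ℂ) * ‖x‖ ^ 2 + Complex.I * ⟪t, x⟫) := fun x => by
    rw [ENNReal.toReal_ofReal (h0 x), Complex.real_smul, Complex.exp_add, real_inner_comm]
    push_cast
    rw [mul_comm Complex.I, mul_assoc]
  simp_rw [hcongr]
  rw [integral_const_mul, key]
  have hCC : ((Real.pi : ℂ) / (1 / 2)) ^ ((Module.finrank ℝ E : ℂ) / 2) = (C : ℂ) := by
    rw [hCdef, Complex.ofReal_cpow (by positivity)]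
    push_cast
    rfl
  rw [hCC, ← mul_assoc, ← Complex.ofReal_mul, inv_mul_cancel₀ hC.ne', Complex.ofReal_one, one_mul,
    Complex.I_sq]
  congr 1
  ring

theorem map_withDensity_continuousLinearEquiv {E : Type*} [NormedAddCommGroup E] [NormedSpace ℝ E]
    [FiniteDimensional ℝ E] [MeasurableSpace E] [BorelSpace E] (μ : Measure E) [μ.IsAddHaarMeasure]
    (B : E ≃L[ℝ] E) {G : E → ℝ≥0∞} (hG : Measurable G) :
    (μ.withDensity G).map B =
      μ.withDensity fun y => ENNReal.ofReal |(LinearMap.det (B : E →ₗ[ℝ] E))⁻¹| * G (B.symm y) := by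
  have hdet : LinearMap.det (B : E →ₗ[ℝ] E) ≠ 0 := (LinearEquiv.isUnit_det' B.toLinearEquiv).ne_zero
  have hmap : μ.map B = ENNReal.ofReal |(LinearMap.det (B : E →ₗ[ℝ] E))⁻¹| • μ :=
    Measure.map_linearMap_addHaar_eq_smul_addHaar μ hdet
  have hGs : Measurable fun y => G (B.symm y) := hG.comp B.symm.continuous.measurable
  have hB : Measurable B := B.continuous.measurable
  refine Measure.ext_of_lintegral _ fun φ hφ => ?_
  have hGφ : Measurable fun y => G (B.symm y) * φ y := hGs.mul hφ
  have hφB : Measurable fun x => φ (B x) := hφ.comp hB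
  rw [lintegral_map hφ hB, lintegral_withDensity_eq_lintegral_mul _ hG hφB,
    lintegral_withDensity_eq_lintegral_mul _ (hGs.const_mul _) hφ]
  have h1 : ∫⁻ x, (G * fun x => φ (B x)) x ∂μ = ∫⁻ y, G (B.symm y) * φ y ∂(μ.map B) := by
    rw [lintegral_map hGφ hB]
    simp
  rw [h1, hmap, lintegral_smul_measure, smul_eq_mul,
    ← lintegral_const_mul _ hGφ]
  simp [mul_assoc]

open scoped MatrixOrder Matrix.Norms.L2Operator in
/-- A nondegenerate centred Gaussian measure has density proportional to `exp (-‖T z‖²)` for an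
invertible `T`. -/
theorem multivariateGaussian_eq_withDensity {d : ℕ} {S : Matrix (Fin d) (Fin d) ℝ}
    (hS : S.PosDef) :
    ∃ (T : EuclideanSpace ℝ (Fin d) ≃L[ℝ] EuclideanSpace ℝ (Fin d)) (k : ℝ), 0 < k ∧
      multivariateGaussian 0 S = (volume : Measure (EuclideanSpace ℝ (Fin d))).withDensity
        fun z => ENNReal.ofReal (k * Real.exp (-‖T z‖ ^ 2)) := by
  have hu : IsUnit (CFC.sqrt S) :=
    (CFC.isUnit_sqrt_iff S hS.posSemidef.nonneg).2 hS.isUnit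
  obtain ⟨w, hw⟩ := hu.map (Matrix.toEuclideanCLM (n := Fin d) (𝕜 := ℝ))
  set B := ContinuousLinearEquiv.ofUnit w with hB
  have hBx : ∀ x, B x = Matrix.toEuclideanCLM (𝕜 := ℝ) (CFC.sqrt S) x := fun x => by
    rw [← hw]
    rfl
  obtain ⟨k, hk, hstd⟩ := stdGaussian_eq_withDensity (E := EuclideanSpace ℝ (Fin d))
  have hdet : LinearMap.det (B : EuclideanSpace ℝ (Fin d) →ₗ[ℝ] EuclideanSpace ℝ (Fin d)) ≠ 0 :=
    (LinearEquiv.isUnit_det' B.toLinearEquiv).ne_zero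
  set δ := |(LinearMap.det (B : EuclideanSpace ℝ (Fin d) →ₗ[ℝ] EuclideanSpace ℝ (Fin d)))⁻¹|
  have hδ : 0 < δ := abs_pos.2 (inv_ne_zero hdet)
  have hs2 : √(1 / 2 : ℝ) ≠ 0 := by positivity
  -- `T = S^(-1/2) / √2`; the factor `1 / √2` absorbs the `1 / 2` in the Gaussian exponent, to match
  -- the unscaled squared distance in the score.
  refine ⟨B.symm.trans (ContinuousLinearEquiv.smulLeft (Units.mk0 _ hs2)), δ * k, by positivity, ?_⟩
  have hmap : multivariateGaussian 0 S = (stdGaussian (EuclideanSpace ℝ (Fin d))).map B := by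
    rw [multivariateGaussian]
    congr 1
    ext1 x
    rw [hBx, zero_add]
  rw [hmap, hstd, map_withDensity_continuousLinearEquiv _ _ (by fun_prop)]
  congr 1
  ext1 y
  rw [← ENNReal.ofReal_mul hδ.le, ← mul_assoc]
  congr 3
  simp only [ContinuousLinearEquiv.trans_apply, ContinuousLinearEquiv.smulLeft_apply_apply]
  rw [Units.smul_mk0, norm_smul, mul_pow, Real.norm_eq_abs, sq_abs, Real.sq_sqrt (by norm_num)]
  ring

/-- Given `x`, the successor has the noise density translated by `f x`; dividing by `ρ` changes the
reference measure from Lebesgue to `q`. -/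
theorem consecutiveLatentLaw_eq_withDensity {d : ℕ}
    {f : EuclideanSpace ℝ (Fin d) → EuclideanSpace ℝ (Fin d)} (hf : Measurable f)
    {S : Matrix (Fin d) (Fin d) ℝ} {G : EuclideanSpace ℝ (Fin d) → ℝ} (hG : Measurable G)
    (hS : multivariateGaussian 0 S =
      (volume : Measure (EuclideanSpace ℝ (Fin d))).withDensity fun z => ENNReal.ofReal (G z))
    {q : Measure (EuclideanSpace ℝ (Fin d))} [SFinite q]
    {ρ : EuclideanSpace ℝ (Fin d) → ℝ} (hρ : Measurable ρ) (hρ_pos : ∀ x, 0 < ρ x)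
    (hq : q = (volume : Measure (EuclideanSpace ℝ (Fin d))).withDensity
      (fun x => ENNReal.ofReal (ρ x))) :
    consecutiveLatentLaw f S q =
      (q.prod q).withDensity fun p => ENNReal.ofReal (G (p.2 - f p.1) / ρ p.2) := by
  have hadd : Measurable fun p : EuclideanSpace ℝ (Fin d) × EuclideanSpace ℝ (Fin d) =>
      (p.1, f p.1 + p.2) := by fun_prop
  have hdens : Measurable fun p : EuclideanSpace ℝ (Fin d) × EuclideanSpace ℝ (Fin d) =>
      ENNReal.ofReal (G (p.2 - f p.1) / ρ p.2) :=
    ((hG.comp (by fun_prop)).div (hρ.comp measurable_snd)).ennreal_ofReal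
  refine Measure.ext_of_lintegral _ fun φ hφ => ?_
  have hφadd : Measurable fun p : EuclideanSpace ℝ (Fin d) × EuclideanSpace ℝ (Fin d) =>
      φ (p.1, f p.1 + p.2) := hφ.comp hadd
  rw [consecutiveLatentLaw, lintegral_map hφ hadd, lintegral_prod _ hφadd.aemeasurable,
    lintegral_withDensity_eq_lintegral_mul _ hdens hφ,
    lintegral_prod _ (hdens.mul hφ).aemeasurable]
  refine lintegral_congr fun x => ?_
  have hφx : Measurable fun z => φ (x, z) := hφ.comp measurable_prodMk_left
  have h1 : ∫⁻ z, φ (x, f x + z) ∂(multivariateGaussian 0 S) =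
      ∫⁻ y, ENNReal.ofReal (G (y - f x)) * φ (x, y) := by
    have hφx' : Measurable fun z => φ (x, f x + z) := hφx.comp (measurable_const_add _)
    rw [hS, lintegral_withDensity_eq_lintegral_mul _ hG.ennreal_ofReal hφx',
      ← lintegral_add_left_eq_self (μ := volume)
        (fun y => ENNReal.ofReal (G (y - f x)) * φ (x, y)) (f x)]
    simp
  have h2 : ∫⁻ y, ENNReal.ofReal (G (y - f x) / ρ y) * φ (x, y) ∂q =
      ∫⁻ y, ENNReal.ofReal (G (y - f x)) * φ (x, y) := by
    have hdφ : Measurable fun y => ENNReal.ofReal (G (y - f x) / ρ y) * φ (x, y) :=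
      (hdens.comp measurable_prodMk_left).mul hφx
    rw [hq, lintegral_withDensity_eq_lintegral_mul _ hρ.ennreal_ofReal hdφ]
    refine lintegral_congr fun y => ?_
    simp only [Pi.mul_apply]
    rw [← mul_assoc, ← ENNReal.ofReal_mul (hρ_pos y).le, mul_div_cancel₀ _ (hρ_pos y).ne']
  exact h1.trans h2.symm

/-! ### Affine identification from squared distances -/

section Identification

variable {E : Type*} [NormedAddCommGroup E] [InnerProductSpace ℝ E] [FiniteDimensional ℝ E]
  [MeasurableSpace E]

/-- The vectors `b` for which `⟪b, ·⟫` is almost everywhere an affine function of `v`. -/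
def affinelyReadable (ν : Measure E) (v : E → E) : Submodule ℝ E where
  carrier := {b | ∃ (a : E) (k : ℝ), ∀ᵐ x ∂ν, ⟪a, v x⟫ = ⟪b, x⟫ + k}
  zero_mem' := ⟨0, 0, by simp⟩
  add_mem' := by
    rintro b b' ⟨a, k, h⟩ ⟨a', k', h'⟩
    refine ⟨a + a', k + k', ?_⟩
    filter_upwards [h, h'] with x hx hx'
    rw [inner_add_left, inner_add_left, hx, hx']
    ring
  smul_mem' := by
    rintro c b ⟨a, k, h⟩
    refine ⟨c • a, c * k, ?_⟩
    filter_upwards [h] with x hx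
    rw [real_inner_smul_left, real_inner_smul_left, hx]
    ring

/-- A subspace containing an invertible affine image of almost every point is everything. -/
theorem submodule_eq_top_of_ae_mem {ν : Measure E} [ν.IsOpenPosMeasure] (p : Submodule ℝ E)
    {f : E → E} (hf : Continuous f) (hf' : Function.Surjective f) (h : ∀ᵐ x ∂ν, f x ∈ p) :
    p = ⊤ := by
  have hd : Dense {x | f x ∈ p} := Measure.dense_of_ae h
  have hc : IsClosed {x | f x ∈ p} := p.closed_of_finiteDimensional.preimage hf
  have huniv : {x | f x ∈ p} = Set.univ := by rw [← hc.closure_eq, hd.closure_eq]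
  refine eq_top_iff.2 fun y _ => ?_
  obtain ⟨x, rfl⟩ := hf' y
  have : x ∈ {x | f x ∈ p} := huniv ▸ Set.mem_univ x
  exact this

/-- Subtracting the identity at a fixed `x₀` from the one at `x` cancels `‖v x'‖ ^ 2` and `‖T x'‖ ^
2`. What remains makes `T* B (x - x₀)` readable for almost every `x`, and these vectors are dense.
-/
theorem affinelyReadable_eq_top {ν : Measure E} [ν.IsOpenPosMeasure] {v u : E → E}
    {B T : E →L[ℝ] E} (hB : Function.Surjective B) 
    (hT : Function.Surjective (ContinuousLinearMap.adjoint T))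
    (h : ∀ᵐ x ∂ν, ∃ c : ℝ, ∀ᵐ x' ∂ν, ‖u x - v x'‖ ^ 2 = ‖B x - T x'‖ ^ 2 + c) :
    affinelyReadable ν v = ⊤ := by
  obtain ⟨x₀, c₀, h₀⟩ : ∃ x, ∃ c : ℝ, ∀ᵐ x' ∂ν, ‖u x - v x'‖ ^ 2 = ‖B x - T x'‖ ^ 2 + c :=
    h.exists
  refine submodule_eq_top_of_ae_mem (ν := ν) _
    (f := fun x => ContinuousLinearMap.adjoint T (B (x - x₀))) (by fun_prop)
    ((hT.comp hB).comp (fun y => ⟨y + x₀, add_sub_cancel_right y x₀⟩)) ?_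
  filter_upwards [h] with x ⟨c, hx⟩
  refine ⟨u x - u x₀, (‖u x‖ ^ 2 - ‖u x₀‖ ^ 2 - ‖B x‖ ^ 2 + ‖B x₀‖ ^ 2 - c + c₀) / 2, ?_⟩
  filter_upwards [hx, h₀] with x' h1 h2
  rw [norm_sub_sq_real, norm_sub_sq_real] at h1 h2
  rw [ContinuousLinearMap.adjoint_inner_left, map_sub, inner_sub_left, inner_sub_left]
  linarith

/-- Reading off the coordinates of `x` in an orthonormal basis gives a linear `U` with `U (v x) = x
+ b`. The range of `U` contains almost every translate `x + b`, so `U` is invertible and can be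
undone. -/
theorem ae_eq_affine_of_affinelyReadable {ν : Measure E} [ν.IsOpenPosMeasure] {v : E → E}
    (h : affinelyReadable ν v = ⊤) :
    ∃ (L : E ≃L[ℝ] E) (b : E), ∀ᵐ x ∂ν, v x = L x + b := by
  set e := stdOrthonormalBasis ℝ E
  have hmem : ∀ i, e i ∈ affinelyReadable ν v := fun i => h ▸ Submodule.mem_top
  choose a k hak using hmem
  set U : E →ₗ[ℝ] E := ∑ i, (innerₛₗ ℝ (a i)).smulRight (e i) with hU
  set b : E := ∑ i, k i • e i with hb
  have hUv : ∀ᵐ x ∂ν, U (v x) = x + b := by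
    filter_upwards [ae_all_iff.2 hak] with x hx
    have : U (v x) = ∑ i, ⟪a i, v x⟫ • e i := by simp [hU]
    rw [this]
    simp_rw [hx, add_smul, Finset.sum_add_distrib]
    rw [e.sum_repr']
  have hsurj : Function.Surjective U := by
    rw [← LinearMap.range_eq_top]
    refine submodule_eq_top_of_ae_mem (ν := ν) _ (f := fun x => x + b) (by fun_prop)
      (add_right_surjective b) ?_
    filter_upwards [hUv] with x hx
    exact ⟨v x, hx⟩
  have hinj : Function.Injective U := LinearMap.injective_iff_surjective.2 hsurj
  set L := (LinearEquiv.ofBijective U ⟨hinj, hsurj⟩).toContinuousLinearEquiv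
  refine ⟨L.symm, L.symm b, ?_⟩
  filter_upwards [hUv] with x hx
  rw [← map_add, ContinuousLinearEquiv.eq_symm_apply, ← hx]
  rfl

omit [FiniteDimensional ℝ E] in
-- Both sides are quadratic polynomials in `x'`. The quadratic parts make `L` and `T` induce the
-- same inner product, and the linear parts then identify `Ahat (L x + b) - b` with `L (A x)`.
theorem intertwines_of_norm_sub_sq_eq {ν : Measure E} [ν.IsOpenPosMeasure]
    {A Ahat T : E →L[ℝ] E} {L : E ≃L[ℝ] E} {b : E}
    (h : ∀ᵐ x ∂ν, ∃ c : ℝ, ∀ᵐ x' ∂ν,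
      ‖Ahat (L x + b) - (L x' + b)‖ ^ 2 = ‖T (A x) - T x'‖ ^ 2 + c) (x : E) :
    Ahat (L x) = L (A x) := by
  have key : ∀ᵐ x ∂ν, Ahat (L x + b) - b = L (A x) := by
    filter_upwards [h] with x ⟨c, hx⟩
    have hall : ∀ x', ‖Ahat (L x + b) - (L x' + b)‖ ^ 2 = ‖T (A x) - T x'‖ ^ 2 + c :=
      fun x' => congrFun (Continuous.ae_eq_iff_eq ν (by fun_prop) (by fun_prop) |>.1 hx) x'
    set w := Ahat (L x + b) - b with hw
    have hall' : ∀ y, ‖w‖ ^ 2 - 2 * ⟪w, L y⟫ + ‖L y‖ ^ 2 =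
        ‖T (A x)‖ ^ 2 - 2 * ⟪T (A x), T y⟫ + ‖T y‖ ^ 2 + c := fun y => by
      rw [← norm_sub_sq_real, ← norm_sub_sq_real, ← hall y, hw]
      congr 2
      abel
    have h0 := hall' 0
    simp only [map_zero, inner_zero_right, norm_zero] at h0
    -- The values at `y`, `-y` and `0` isolate the even part and eliminate the constant.
    have hnorm : ∀ y, ‖L y‖ ^ 2 = ‖T y‖ ^ 2 := fun y => by
      have h1 := hall' y
      have h2 := hall' (-y)
      simp only [map_neg, inner_neg_right, norm_neg] at h2
      linarith
    have hlin : ∀ y, ⟪w, L y⟫ = ⟪T (A x), T y⟫ := fun y => by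
      have h1 := hall' y
      have h2 := hnorm y
      linarith
    have hpol : ∀ y z, ⟪L y, L z⟫ = ⟪T y, T z⟫ := fun y z => by
      have h1 := hnorm (y + z)
      rw [map_add, map_add, norm_add_sq_real, norm_add_sq_real, hnorm y, hnorm z] at h1
      linarith
    refine ext_inner_right ℝ fun z => ?_
    obtain ⟨y, rfl⟩ := L.surjective z
    rw [hlin, hpol]
  have hall := Continuous.ae_eq_iff_eq ν (by fun_prop) (by fun_prop) |>.1 key
  -- At `x = 0` this says that `Ahat` fixes `b`, so the translation drops out.
  have h0 := congrFun hall 0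
  have h1 := congrFun hall x
  simp only [map_zero, map_add, zero_add] at h0 h1
  rw [← h1, add_sub_assoc, h0, add_zero]

end Identification

/-! ### The loss over independent samples, and the main theorem -/

/-- The contrastive loss as an integral over independent samples, when consecutive latents have
density `r` with respect to independent ones. -/
theorem dclLoss_eq_lintegral {d D M : ℕ}
    {f : EuclideanSpace ℝ (Fin d) → EuclideanSpace ℝ (Fin d)} {S : Matrix (Fin d) (Fin d) ℝ}
    {q : Measure (EuclideanSpace ℝ (Fin d))} [IsProbabilityMeasure q]
    {g : EuclideanSpace ℝ (Fin d) → EuclideanSpace ℝ (Fin D)}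
    {ψ : EuclideanSpace ℝ (Fin D) → EuclideanSpace ℝ (Fin D) → ℝ}
    {r s : EuclideanSpace ℝ (Fin d) → EuclideanSpace ℝ (Fin d) → ℝ}
    (hr : Measurable (Function.uncurry r)) (hs : Measurable (Function.uncurry s))
    (hlaw : consecutiveLatentLaw f S q = (q.prod q).withDensity fun p => ENNReal.ofReal (r p.1 p.2))
    (hψ : ∀ x x', Real.exp (ψ (g x) (g x')) = s x x') :
    dclLoss M f S q g ψ =
      ∫⁻ x, ∫⁻ z : Fin (M + 1) → EuclideanSpace ℝ (Fin d), ENNReal.ofReal (r x (z 0)) *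
        ENNReal.ofReal (-Real.log (s x (z 0) / ∑ i, s x (z i))) ∂(Measure.pi fun _ => q) ∂q := by
  have hs0 : ∀ x x', 0 < s x x' := fun x x' => hψ x x' ▸ Real.exp_pos _
  have hlik : ∀ x x' (n : Fin M → EuclideanSpace ℝ (Fin d)),
      -contrastiveLogLik ψ (g x) (g x') (fun m => g (n m)) =
        -Real.log (s x x' / (s x x' + ∑ m, s x (n m))) := fun x x' n => by
    have h0 : 0 < s x x' + ∑ m, s x (n m) :=
      add_pos_of_pos_of_nonneg (hs0 _ _) (Finset.sum_nonneg fun m _ => (hs0 _ _).le)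
    rw [Real.log_div (hs0 x x').ne' h0.ne', contrastiveLogLik, hψ]
    simp_rw [hψ]
    rw [← hψ x x', Real.log_exp]
  have mcoord : ∀ i, Measurable fun p : (EuclideanSpace ℝ (Fin d) × EuclideanSpace ℝ (Fin d)) ×
      (Fin M → EuclideanSpace ℝ (Fin d)) => s p.1.1 (p.2 i) := fun i => by
    have hpair : Measurable fun p : (EuclideanSpace ℝ (Fin d) × EuclideanSpace ℝ (Fin d)) ×
        (Fin M → EuclideanSpace ℝ (Fin d)) => (p.1.1, p.2 i) := by fun_prop
    exact hs.comp hpair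
  have mfst : Measurable fun p : (EuclideanSpace ℝ (Fin d) × EuclideanSpace ℝ (Fin d)) ×
      (Fin M → EuclideanSpace ℝ (Fin d)) => s p.1.1 p.1.2 := hs.comp measurable_fst
  have mF : Measurable fun p : (EuclideanSpace ℝ (Fin d) × EuclideanSpace ℝ (Fin d)) ×
      (Fin M → EuclideanSpace ℝ (Fin d)) =>
      ENNReal.ofReal (-Real.log (s p.1.1 p.1.2 / (s p.1.1 p.1.2 + ∑ m, s p.1.1 (p.2 m)))) :=
    (mfst.div (mfst.add (Finset.measurable_sum _ fun m _ => mcoord m))).log.neg.ennreal_ofReal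
  have mI := mF.lintegral_prod_right' (ν := Measure.pi fun _ : Fin M => q)
  have mr : Measurable fun p : EuclideanSpace ℝ (Fin d) × EuclideanSpace ℝ (Fin d) =>
      ENNReal.ofReal (r p.1 p.2) := hr.ennreal_ofReal
  unfold dclLoss
  simp_rw [hlik]
  rw [hlaw, lintegral_withDensity_eq_lintegral_mul _ mr mI,
    lintegral_prod _ (mr.mul mI).aemeasurable]
  refine lintegral_congr fun x => ?_
  have mz : ∀ i, Measurable fun z : Fin (M + 1) → EuclideanSpace ℝ (Fin d) => s x (z i) := fun i =>
    hs.comp (measurable_const.prodMk (measurable_pi_apply i))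
  have mrz : Measurable fun z : Fin (M + 1) → EuclideanSpace ℝ (Fin d) => r x (z 0) :=
    hr.comp (measurable_const.prodMk (measurable_pi_apply 0))
  have mall : Measurable fun z : Fin (M + 1) → EuclideanSpace ℝ (Fin d) =>
      ENNReal.ofReal (r x (z 0)) * ENNReal.ofReal (-Real.log (s x (z 0) / ∑ i, s x (z i))) :=
    mrz.ennreal_ofReal.mul
      ((mz 0).div (Finset.measurable_sum _ fun i _ => mz i)).log.neg.ennreal_ofReal
  rw [lintegral_pi_fin_succ q mall]
  refine lintegral_congr fun x' => ?_
  simp only [Pi.mul_apply, Fin.sum_univ_succ, Fin.cons_zero, Fin.cons_succ]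
  have mFx : Measurable fun n : Fin M → EuclideanSpace ℝ (Fin d) =>
      ENNReal.ofReal (-Real.log (s x x' / (s x x' + ∑ m, s x (n m)))) :=
    mF.comp (measurable_prodMk_left (x := (x, x')))
  exact (lintegral_const_mul _ mFx).symm

theorem corollary2 {d D M : ℕ} (hM : 1 ≤ M)
    -- ground truth: bijective linear dynamics, Gaussian noise, injective mixing function
    (A : Matrix (Fin d) (Fin d) ℝ) (hA : Function.Bijective (linearDynamics A))
    (S : Matrix (Fin d) (Fin d) ℝ) (hS : S.PosDef)
    (g : EuclideanSpace ℝ (Fin d) → EuclideanSpace ℝ (Fin D))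
    (hg : Measurable g) (hg_inj : Function.Injective g)
    -- the data marginal, with positive density `ρ`
    (q : Measure (EuclideanSpace ℝ (Fin d))) [IsProbabilityMeasure q]
    (ρ : EuclideanSpace ℝ (Fin d) → ℝ) (hρ : Measurable ρ) (hρ_pos : ∀ x, 0 < ρ x)
    (hq : q = (volume : Measure (EuclideanSpace ℝ (Fin d))).withDensity
      (fun x => ENNReal.ofReal (ρ x)))
    -- the model: encoder, linear dynamics model, correction term `α = log q`
    (h : EuclideanSpace ℝ (Fin D) → EuclideanSpace ℝ (Fin d)) (hh : Measurable h)
    (Ahat : Matrix (Fin d) (Fin d) ℝ)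
    (α : EuclideanSpace ℝ (Fin D) → ℝ) (hα : ∀ x, α (g x) = Real.log (ρ x))
    -- the model attains the global minimum of the loss
    (hmin : ∀ h' : EuclideanSpace ℝ (Fin D) → EuclideanSpace ℝ (Fin d), Measurable h' →
      ∀ A' : Matrix (Fin d) (Fin d) ℝ,
        dclLoss M (linearDynamics A) S q g (dclScore h (linearDynamics Ahat) α) ≤
          dclLoss M (linearDynamics A) S q g (dclScore h' (linearDynamics A') α)) :
    ∃ (L : Matrix (Fin d) (Fin d) ℝ) (b : EuclideanSpace ℝ (Fin d)),
      IsUnit L.det ∧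
      (∀ᵐ x ∂q, h (g x) = linearDynamics L x + b) ∧
      (Continuous (fun x => h (g x)) → ∀ x, h (g x) = linearDynamics L x + b) ∧
      Ahat = L * A * L⁻¹ := by
  -- Positivity of `ρ` gives `q` and Lebesgue measure the same null sets.
  have hae : ∀ p : EuclideanSpace ℝ (Fin d) → Prop, (∀ᵐ x ∂q, p x) ↔ ∀ᵐ x, p x := fun p => by
    rw [hq, ae_withDensity_iff hρ.ennreal_ofReal]
    simp [hρ_pos]
  obtain ⟨T, k, hk, hN⟩ := multivariateGaussian_eq_withDensity hS
  have hdyn : ∀ B : Matrix (Fin d) (Fin d) ℝ, Measurable (linearDynamics B) := fun B =>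
    (Matrix.toEuclideanCLM (n := Fin d) (𝕜 := ℝ) B).continuous.measurable
  have hscore : ∀ (h' : EuclideanSpace ℝ (Fin D) → EuclideanSpace ℝ (Fin d))
      (B : Matrix (Fin d) (Fin d) ℝ) (x x' : EuclideanSpace ℝ (Fin d)),
      Real.exp (dclScore h' (linearDynamics B) α (g x) (g x')) =
        Real.exp (-‖linearDynamics B (h' (g x)) - h' (g x')‖ ^ 2) / ρ x' := fun h' B x x' => by
    rw [dclScore, hα, Real.exp_sub, Real.exp_log (hρ_pos x')]
  have hscore_meas : ∀ (h' : EuclideanSpace ℝ (Fin D) → EuclideanSpace ℝ (Fin d))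
      (B : Matrix (Fin d) (Fin d) ℝ), Measurable h' → Measurable (Function.uncurry
        fun x x' => Real.exp (-‖linearDynamics B (h' (g x)) - h' (g x')‖ ^ 2) / ρ x') :=
    fun h' B hh' => by
      have h1 : Measurable fun p : EuclideanSpace ℝ (Fin d) × EuclideanSpace ℝ (Fin d) =>
          linearDynamics B (h' (g p.1)) - h' (g p.2) :=
        ((hdyn B).comp (hh'.comp (hg.comp measurable_fst))).sub
          (hh'.comp (hg.comp measurable_snd))
      exact (h1.norm.pow_const 2).neg.exp.div (hρ.comp measurable_snd)
  set r : EuclideanSpace ℝ (Fin d) → EuclideanSpace ℝ (Fin d) → ℝ := fun x x' =>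
    k * Real.exp (-‖T (x' - linearDynamics A x)‖ ^ 2) / ρ x' with hr_def
  have hr : Measurable (Function.uncurry r) := by
    have h1 : Measurable fun p : EuclideanSpace ℝ (Fin d) × EuclideanSpace ℝ (Fin d) =>
        T (p.2 - linearDynamics A p.1) :=
      T.continuous.measurable.comp (measurable_snd.sub ((hdyn A).comp measurable_fst))
    exact ((h1.norm.pow_const 2).neg.exp.const_mul k).div (hρ.comp measurable_snd)
  have hr0 : ∀ x x', 0 < r x x' := fun x x' => div_pos (mul_pos hk (Real.exp_pos _)) (hρ_pos x')
  have hlaw : consecutiveLatentLaw (linearDynamics A) S q =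
      (q.prod q).withDensity fun p => ENNReal.ofReal (r p.1 p.2) :=
    consecutiveLatentLaw_eq_withDensity (hdyn A) (G := fun z => k * Real.exp (-‖T z‖ ^ 2))
      (by fun_prop) hN hρ hρ_pos hq
  have hr1 : ∫⁻ x, ∫⁻ x', ENNReal.ofReal (r x x') ∂q ∂q = 1 := by
    have hprob : IsProbabilityMeasure (consecutiveLatentLaw (linearDynamics A) S q) :=
      Measure.isProbabilityMeasure_map (measurable_fst.prodMk
        (((hdyn A).comp measurable_fst).add measurable_snd)).aemeasurable
    have hm : Measurable fun p : EuclideanSpace ℝ (Fin d) × EuclideanSpace ℝ (Fin d) =>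
        ENNReal.ofReal (r p.1 p.2) := hr.ennreal_ofReal
    have huniv := hprob.measure_univ
    rwa [hlaw, withDensity_apply _ MeasurableSet.univ, Measure.restrict_univ,
      lintegral_prod _ hm.aemeasurable] at huniv
  -- The optimal encoder is `T ∘ g⁻¹` on the range of `g`; it extends measurably because an
  -- injective Borel map between these spaces is a measurable embedding.
  obtain ⟨h', hh', hh'g⟩ := (hg.measurableEmbedding hg_inj).exists_measurable_extend
    T.continuous.measurable fun _ => inferInstance
  have hh'g : ∀ x, h' (g x) = T x := congrFun hh'g
  set toCLM := Matrix.toEuclideanCLM (n := Fin d) (𝕜 := ℝ)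
  set A' : Matrix (Fin d) (Fin d) ℝ := toCLM.symm
    ((T : EuclideanSpace ℝ (Fin d) →L[ℝ] EuclideanSpace ℝ (Fin d)) ∘L toCLM A ∘L
      (T.symm : EuclideanSpace ℝ (Fin d) →L[ℝ] EuclideanSpace ℝ (Fin d)))
  have hA' : ∀ x, linearDynamics A' (T x) = T (linearDynamics A x) := fun x => by
    have : toCLM A' (T x) = T (toCLM A x) := by
      rw [StarAlgEquiv.apply_symm_apply]
      simp
    exact this
  -- The competitor's score is `r` up to a constant, which cancels in the softmax.
  have htrue : ∀ x x', Real.exp (-‖linearDynamics A' (h' (g x)) - h' (g x')‖ ^ 2) / ρ x' =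
      k⁻¹ * r x x' := fun x x' => by
    rw [hh'g, hh'g, hA', ← map_sub, hr_def, ← norm_neg, ← map_neg, neg_sub]
    field_simp
  have hle := hmin h' hh' A'
  rw [dclLoss_eq_lintegral hr (hscore_meas h Ahat hh) hlaw (hscore h Ahat),
    dclLoss_eq_lintegral hr (hscore_meas h' A' hh') hlaw (hscore h' A')] at hle
  simp_rw [htrue, ← Finset.mul_sum, mul_div_mul_left _ _ (inv_pos.2 hk).ne'] at hle
  have hratio := ae_exists_eq_mul_of_contrastive_loss_le q hM hr (hscore_meas h Ahat hh) hr0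
    (fun x x' => div_pos (Real.exp_pos _) (hρ_pos x')) hr1 hle
  have hquad : ∀ᵐ x, ∃ c : ℝ, ∀ᵐ x', ‖linearDynamics Ahat (h (g x)) - h (g x')‖ ^ 2 =
      ‖T (linearDynamics A x) - T x'‖ ^ 2 + c := by
    rw [← hae]
    filter_upwards [hratio] with x ⟨c, hc, hx⟩
    refine ⟨-Real.log (c * k), (hae _).1 ?_⟩
    filter_upwards [hx] with x' hx'
    have h1 : Real.exp (-‖linearDynamics Ahat (h (g x)) - h (g x')‖ ^ 2) =
        c * k * Real.exp (-‖T (x' - linearDynamics A x)‖ ^ 2) := by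
      have := (hρ_pos x').ne'
      simp only [hr_def] at hx'
      field_simp at hx'
      linarith
    have h2 := congrArg Real.log h1
    rw [Real.log_exp, Real.log_mul (mul_pos hc hk).ne' (Real.exp_ne_zero _), Real.log_exp,
      map_sub, norm_sub_rev (T x')] at h2
    linarith
  have hTadj : Function.Surjective (ContinuousLinearMap.adjoint
      (T : EuclideanSpace ℝ (Fin d) →L[ℝ] EuclideanSpace ℝ (Fin d))) := fun y => by
    refine ⟨ContinuousLinearMap.adjoint
      (T.symm : EuclideanSpace ℝ (Fin d) →L[ℝ] EuclideanSpace ℝ (Fin d)) y, ?_⟩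
    refine ext_inner_right ℝ fun z => ?_
    rw [ContinuousLinearMap.adjoint_inner_left, ContinuousLinearMap.adjoint_inner_left]
    simp
  obtain ⟨L, b, hLb⟩ := ae_eq_affine_of_affinelyReadable
    (affinelyReadable_eq_top (u := fun x => linearDynamics Ahat (h (g x)))
      (v := fun x => h (g x))
      (B := (T : EuclideanSpace ℝ (Fin d) →L[ℝ] EuclideanSpace ℝ (Fin d)) ∘L toCLM A)
      (T := (T : EuclideanSpace ℝ (Fin d) →L[ℝ] EuclideanSpace ℝ (Fin d)))
      (T.surjective.comp hA.surjective) hTadj hquad)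
  have hinter := intertwines_of_norm_sub_sq_eq (ν := volume) (A := toCLM A) (Ahat := toCLM Ahat)
    (T := (T : EuclideanSpace ℝ (Fin d) →L[ℝ] EuclideanSpace ℝ (Fin d))) (L := L) (b := b) (by
      filter_upwards [hquad, hLb] with x ⟨c, hx⟩ hxL
      refine ⟨c, ?_⟩
      filter_upwards [hx, hLb] with x' hx' hxL'
      rw [← hxL, ← hxL']
      exact hx')
  set Lm : Matrix (Fin d) (Fin d) ℝ :=
    toCLM.symm (L : EuclideanSpace ℝ (Fin d) →L[ℝ] EuclideanSpace ℝ (Fin d)) with hLm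
  have hLmx : ∀ x, linearDynamics Lm x = L x := fun x => by
    have : toCLM Lm x = L x := by
      rw [StarAlgEquiv.apply_symm_apply]
      rfl
    exact this
  have hunit : IsUnit Lm :=
    (ContinuousLinearMap.isUnit_iff_bijective.2 L.bijective).map toCLM.symm
  have hdet : IsUnit Lm.det := (Matrix.isUnit_iff_isUnit_det Lm).1 hunit
  have haff : ∀ᵐ x, h (g x) = linearDynamics Lm x + b := by
    filter_upwards [hLb] with x hx
    rw [hx, hLmx]
  refine ⟨Lm, b, hdet, (hae _).2 haff, fun hcont x => ?_, ?_⟩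
  · have hc : Continuous fun x => linearDynamics Lm x + b :=
      (toCLM Lm).continuous.add continuous_const
    exact congrFun ((Continuous.ae_eq_iff_eq volume hcont hc).1 haff) x
  · have hcomm : Ahat * Lm = Lm * A := by
      refine EquivLike.injective toCLM ?_
      rw [map_mul, map_mul, hLm, StarAlgEquiv.apply_symm_apply]
      ext1 x
      exact hinter x
    rw [← hcomm, Matrix.mul_nonsing_inv_cancel_right _ _ hdet]
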